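/- Fix an optimal (additively universal) prefix-free machine $U$. For a natural number, string or other finite object $a$, let $K(a)$ be the least length of a program on which $U$ outputs $a$. A dyadic cube of side $2^{-n}$ is a set $[i2^{-n},(i+1)2^{-n})\times[j2^{-n},(j+1)2^{-n})$ with $i,j\in\mathbb Z$, coded by $(n,i,j)$; $\mathcal D_{2^{-n}}$ is the set of those contained in $[0,1]^2$. For $x\in\mathbb R^2$ let $K_n(x)=K(Q)$, where $Q$ is the dyadic cube of side $2^{-n}$ containing $x$, and let $\dim(x)=\liminf_{n\to\infty}K_n(x)/n$ be the effective Hausdorff dimension of $x$. A set $A\subseteq\mathcal D_{2^{-n}}$ is a *dyadic $(2^{-n},s,C)$-set* if for each $m\le n$ and each $Q\in\mathcal D_{2^{-m}}$, at most $C2^{-sm}|A|$ cubes of $A$ are contained in $Q$. Fix a procedure $E$ that on an input $(n,w)$, with $n\in\mathbb N$ and $w$ a binary string of length $|w|$, computably enumerates a set of dyadic cubes; a set $\mathcal P\subseteq\mathcal D_{2^{-n}}$ is *enumerable given $w$* if $E$ on input $(n,w)$ enumerates exactly $\mathcal P$. **Proposition.** For every $\varepsilon_0>0$ there is a constant $c>0$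 (depending only on $U$ and $\varepsilon_0$) such that the following holds. Let $x\in\mathbb R^2$ with $\dim(x)>t>0$, let $0<\varepsilon\le\varepsilon_0$, and let $E$ be an enumeration procedure as above. Then for every sufficiently large $n$ (depending on $x,t,\varepsilon,E$): for every binary string $w$, if $\mathcal P\subseteq\mathcal D_{2^{-n}}$ is enumerable given $w$ and contains the dyadic cube of side $2^{-n}$ containing $x$, then $\mathcal P$ has a subset $\mathcal P'$ that is a dyadic $(2^{-n},t,C)$-set with $C=2^{c\varepsilon n+|w|}$ and satisfies $$|\mathcal P'|\ge 2^{K_n(x)-c\,\varepsilon^{-1}\log_2 n-|w|}.$$ In particular, for every $\varepsilon_0>0$ and $a>0$ there is a constant $c>0$ (depending only on $U,\varepsilon_0,a$) such that for all $x,t,\varepsilon,E$ as above and all sufficiently large $n$: if moreover $|w|\le a\log_2 n$, then $\mathcal P$ has a subset $\mathcal P'$ that is a dyadic $(2^{-n},t,2^{c\varepsilon n})$-set with $|\mathcal P'|\ge 2^{K_n(x)-c\,\varepsilon^{-1}\log_2 n}$. -/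

import Mathlib

open Filter

noncomputable section

/-! ### Prefix-free Kolmogorov complexity -/

/-- A prefix-free machine: a partial computable map from binary strings (programs) to natural
numbers (codes of the output) such that no halting program is a proper prefix of another one. -/
structure IsPrefixMachine (U : List Bool →. ℕ) : Prop where
  partrec : Partrec U
  prefixFree : ∀ p q : List Bool, (U p).Dom → (U q).Dom → p <+: q → p = q

/-- An optimal (additively universal) prefix-free machine: it simulates every prefix-free machine
with at most a constant overhead in the length of the program. -/
structure IsOptimalPrefixMachine (U : List Bool →. ℕ) : Prop extends IsPrefixMachine U where
  optimal : ∀ V : List Bool →. ℕ, IsPrefixMachine V →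
    ∃ c : ℕ, ∀ p y, y ∈ V p → ∃ q : List Bool, y ∈ U q ∧ q.length ≤ p.length + c

/-- The Kolmogorov complexity `K(a)` with respect to the machine `U`: the least length of a
program on which `U` outputs (the standard code of) `a`. If `U` is optimal, such a program always
exists. -/
def kolmogorov (U : List Bool →. ℕ) {α : Type*} [Primcodable α] (a : α) : ℕ :=
  sInf {l : ℕ | ∃ p : List Bool, Encodable.encode a ∈ U p ∧ p.length = l}

/-! ### Dyadic cubes in the plane -/

/-- `(n, i, j)` stands for the half-open dyadic cube
`[i 2⁻ⁿ, (i+1) 2⁻ⁿ) × [j 2⁻ⁿ, (j+1) 2⁻ⁿ)` of side length `2⁻ⁿ`. -/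
abbrev DyadicCube : Type := ℕ × ℤ × ℤ

namespace DyadicCube

/-- The exponent `n` of the side length `2⁻ⁿ`. -/
def level (Q : DyadicCube) : ℕ := Q.1

/-- The points covered by a dyadic cube. -/
def toSet (Q : DyadicCube) : Set (EuclideanSpace ℝ (Fin 2)) :=
  {y | (Q.2.1 : ℝ) / 2 ^ Q.level ≤ y 0 ∧ y 0 < ((Q.2.1 : ℝ) + 1) / 2 ^ Q.level ∧
    (Q.2.2 : ℝ) / 2 ^ Q.level ≤ y 1 ∧ y 1 < ((Q.2.2 : ℝ) + 1) / 2 ^ Q.level}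

/-- `𝒟_{2⁻ⁿ}`: the dyadic cubes of side length `2⁻ⁿ` in the unit square. -/
def family (n : ℕ) : Set DyadicCube :=
  {Q | Q.level = n ∧ ∀ y ∈ Q.toSet, ∀ k : Fin 2, 0 ≤ y k ∧ y k ≤ 1}

/-- The dyadic cube of side length `2⁻ⁿ` containing the point `x`. -/
def containing (n : ℕ) (x : EuclideanSpace ℝ (Fin 2)) : DyadicCube :=
  (n, ⌊(2 : ℝ) ^ n * x 0⌋, ⌊(2 : ℝ) ^ n * x 1⌋)

theorem mem_toSet_iff (Q : DyadicCube) (x : EuclideanSpace ℝ (Fin 2)) :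
    x ∈ Q.toSet ↔ Q = containing Q.level x := by
  obtain ⟨n, i, j⟩ := Q
  have h2 : (0 : ℝ) < 2 ^ n := by positivity
  have key : ∀ (i : ℤ) (a : ℝ), i = ⌊(2 : ℝ) ^ n * a⌋ ↔
      (i : ℝ) / 2 ^ n ≤ a ∧ a < ((i : ℝ) + 1) / 2 ^ n := by
    intro i a
    rw [eq_comm, Int.floor_eq_iff, div_le_iff₀ h2, lt_div_iff₀ h2, mul_comm]
  simp only [toSet, containing, level, Set.mem_ofPred_eq, Prod.mk.injEq, true_and, key, and_assoc]

end DyadicCube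

/-- `K_n(x)`, the Kolmogorov complexity of `x` at precision `n`: the complexity of the dyadic cube
of side length `2⁻ⁿ` containing `x`. -/
def complexityAt (U : List Bool →. ℕ) (n : ℕ) (x : EuclideanSpace ℝ (Fin 2)) : ℕ :=
  kolmogorov U (DyadicCube.containing n x)

/-- The effective Hausdorff dimension `liminf K_n(x) / n` of a point. -/
def effDim (U : List Bool →. ℕ) (x : EuclideanSpace ℝ (Fin 2)) : ENNReal :=
  liminf (fun n : ℕ => (complexityAt U n x : ENNReal) / (n : ENNReal)) atTop

/-- `P` is enumerable given the string `w`, by the computably enumerable relation `E`, at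
precision `n`: with input `(n, w)`, the procedure `E` enumerates exactly the elements of `P`. -/
def IsEnumeratedBy (E : (ℕ × List Bool) × DyadicCube → Prop) (n : ℕ) (w : List Bool)
    (P : Finset DyadicCube) : Prop :=
  ∀ Q : DyadicCube, Q ∈ P ↔ E ((n, w), Q)

open Classical in
/-- `A ⊆ 𝒟_{2⁻ⁿ}` is a dyadic `(2⁻ⁿ, s, C)`-set: for all `m ≤ n`, every `Q ∈ 𝒟_{2⁻ᵐ}` has at
most `C 2^{-sm} |A|` subcubes in `A`. -/
def IsDyadicSet (n : ℕ) (s C : ℝ) (A : Finset DyadicCube) : Prop :=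
  (∀ Q ∈ A, Q ∈ DyadicCube.family n) ∧
  ∀ m ≤ n, ∀ Q ∈ DyadicCube.family m,
    ((A.filter fun Q' => Q'.toSet ⊆ Q.toSet).card : ℝ) ≤
      C * (2 : ℝ) ^ (-(s * (m : ℝ))) * (A.card : ℝ)

/-! ### Optimal prefix-free machines exist -/

namespace PrefixMachine

open Nat.Partrec (Code)

/-- The `n`-th binary string. -/
def str (n : ℕ) : List Bool := (Encodable.decode (α := List Bool) n).getD []

/-- Within `k` steps, the program `c` halts on a string different from `q` but comparable to it. -/
def Bad (c : Code) (q : List Bool) (k n : ℕ) : Prop :=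
  ¬ str n = q ∧ (q ++ (str n).drop q.length = str n ∨ str n ++ q.drop (str n).length = q) ∧
    (Code.evaln k c (Encodable.encode (str n))).isSome = true

instance (c : Code) (q : List Bool) (k n : ℕ) : Decidable (Bad c q k n) := by
  unfold Bad; infer_instance

/-- The index of the program that is called by `1^e 0 q`. -/
def code (p : List Bool) : Code := Denumerable.ofNat Code (p.idxOf false)

/-- The string `q` in `1^e 0 q`. -/
def arg (p : List Bool) : List Bool := p.drop (p.idxOf false + 1)

/-- `k` steps of the universal machine. -/
def step (p : List Bool) (k : ℕ) : Option ℕ :=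
  if p.idxOf false < p.length ∧ ∀ n < k, ¬ Bad (code p) (arg p) k n then
    Code.evaln k (code p) (Encodable.encode (arg p)) else none

/-- The universal machine: on `1^e 0 q`, run the `e`-th program on `q`, as long as it does not halt
on some other string that is comparable to `q`. -/
def univ (p : List Bool) : Part ℕ := Nat.rfindOpt (step p)

theorem primrec_code : Primrec code :=
  (Primrec.ofNat Code).comp (Primrec.list_idxOf.comp (.const false) .id)

theorem primrec_arg : Primrec arg :=
  Primrec.list_drop.comp
    (Primrec.succ.comp (Primrec.list_idxOf.comp (.const false) .id)) .id

theorem primrec_str : Primrec str :=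
  Primrec.option_getD.comp Primrec.decode (.const [])

theorem primrecPred_bad : PrimrecPred fun z : ℕ × (List Bool × ℕ) =>
    Bad (code z.2.1) (arg z.2.1) z.2.2 z.1 := by
  have hs : Primrec fun z : ℕ × (List Bool × ℕ) => str z.1 := primrec_str.comp .fst
  have ha : Primrec fun z : ℕ × (List Bool × ℕ) => arg z.2.1 :=
    primrec_arg.comp (.comp .fst .snd)
  have hc : Primrec fun z : ℕ × (List Bool × ℕ) => code z.2.1 :=
    primrec_code.comp (.comp .fst .snd)
  have h1 : PrimrecPred fun z : ℕ × (List Bool × ℕ) => str z.1 = arg z.2.1 :=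
    Primrec.eq.comp hs ha
  have h2 : PrimrecPred fun z : ℕ × (List Bool × ℕ) =>
      arg z.2.1 ++ (str z.1).drop (arg z.2.1).length = str z.1 :=
    Primrec.eq.comp (Primrec.list_append.comp ha
      (Primrec.list_drop.comp (Primrec.list_length.comp ha) hs)) hs
  have h3 : PrimrecPred fun z : ℕ × (List Bool × ℕ) =>
      str z.1 ++ (arg z.2.1).drop (str z.1).length = arg z.2.1 :=
    Primrec.eq.comp (Primrec.list_append.comp hs
      (Primrec.list_drop.comp (Primrec.list_length.comp hs) ha)) ha
  have h4 : PrimrecPred fun z : ℕ × (List Bool × ℕ) =>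
      (Code.evaln z.2.2 (code z.2.1) (Encodable.encode (str z.1))).isSome = true :=
    Primrec.eq.comp (Primrec.option_isSome.comp
      (Code.primrec_evaln.comp
        (((Primrec.comp .snd .snd).pair hc).pair (Primrec.encode.comp hs)))) (.const true)
  exact h1.not.and ((h2.or h3).and h4)

theorem primrec_step : Primrec₂ step := by
  have hbad : PrimrecRel fun (n : ℕ) (z : List Bool × ℕ) =>
      ¬ Bad (code z.1) (arg z.1) z.2 n := primrecPred_bad.not
  have hall : PrimrecPred fun z : List Bool × ℕ =>
      ∀ n < z.2, ¬ Bad (code z.1) (arg z.1) z.2 n :=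
    (hbad.forall_mem_list.comp (f := fun z : List Bool × ℕ => List.range z.2) (g := fun z => z)
      (Primrec.list_range.comp .snd) .id).of_eq fun z => by simp
  have hlt : PrimrecPred fun z : List Bool × ℕ => z.1.idxOf false < z.1.length :=
    Primrec.nat_lt.comp (Primrec.list_idxOf.comp (.const false) .fst)
      (Primrec.list_length.comp .fst)
  have hev : Primrec fun z : List Bool × ℕ =>
      Code.evaln z.2 (code z.1) (Encodable.encode (arg z.1)) :=
    Code.primrec_evaln.comp
      ((Primrec.snd.pair (primrec_code.comp .fst)).pair
        (Primrec.encode.comp (primrec_arg.comp .fst)))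
  exact Primrec.ite (hlt.and hall) hev (.const none)

theorem partrec_univ : Partrec univ := Partrec.rfindOpt primrec_step.to_comp

theorem not_bad_of_step {p : List Bool} {k y : ℕ} (h : y ∈ step p k) :
    p.idxOf false < p.length ∧ (∀ q, q ≠ arg p → (arg p <+: q ∨ q <+: arg p) →
      ∀ v, v ∉ Code.evaln k (code p) (Encodable.encode q)) ∧
      y ∈ Code.evaln k (code p) (Encodable.encode (arg p)) := by
  unfold step at h
  split_ifs at h with hc
  · refine ⟨hc.1, fun q hq hcmp v hv => hc.2 (Encodable.encode q) (Code.evaln_bound hv) ?_, h⟩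
    have hs : str (Encodable.encode q) = q := by simp [str]
    refine ⟨by rwa [hs], ?_, ?_⟩
    · rw [hs]
      refine hcmp.imp ?_ ?_
      · rintro ⟨r, hr⟩
        rw [← hr, List.drop_left]
      · rintro ⟨r, hr⟩
        rw [← hr, List.drop_left]
    · rw [hs]
      exact Option.isSome_iff_exists.2 ⟨v, hv⟩
  · simp at h

theorem eq_of_idxOf {p : List Bool} (h : p.idxOf false < p.length) :
    p = List.replicate (p.idxOf false) true ++ false :: arg p := by
  unfold arg
  induction p with
  | nil => simp at h
  | cons b p ih =>
    cases b
    · simp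
    · simp only [List.idxOf_cons, List.length_cons] at h ⊢
      simp only [Bool.true_beq, cond_false] at h ⊢
      have := ih (by simpa using h)
      simpa [List.replicate_succ] using this

theorem idxOf_replicate (e : ℕ) (q : List Bool) :
    (List.replicate e true ++ false :: q).idxOf false = e := by
  induction e with
  | zero => simp
  | succ e ih => simpa [List.replicate_succ, List.idxOf_cons] using ih

theorem arg_replicate (e : ℕ) (q : List Bool) :
    arg (List.replicate e true ++ false :: q) = q := by
  rw [arg, idxOf_replicate, List.drop_append]
  simp

theorem idxOf_eq_of_prefix {p q : List Bool} (hp : p.idxOf false < p.length) (h : p <+: q) :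
    p.idxOf false = q.idxOf false := by
  obtain ⟨r, rfl⟩ := h
  rw [eq_of_idxOf hp, List.append_assoc, List.cons_append, idxOf_replicate, idxOf_replicate]

theorem isPrefixMachine_univ : IsPrefixMachine univ := by
  refine ⟨partrec_univ, fun p q hp hq hpq => ?_⟩
  obtain ⟨k, y, hy⟩ := Nat.rfindOpt_dom.1 hp
  obtain ⟨l, z, hz⟩ := Nat.rfindOpt_dom.1 hq
  obtain ⟨hp1, hp2, hp3⟩ := not_bad_of_step hy
  obtain ⟨hq1, hq2, hq3⟩ := not_bad_of_step hz
  have hi := idxOf_eq_of_prefix hp1 hpq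
  have hcode : code p = code q := by rw [code, code, hi]
  have harg : arg p <+: arg q := by
    obtain ⟨r, rfl⟩ := hpq
    refine ⟨r, ?_⟩
    rw [arg, arg, ← hi, List.drop_append_of_le_length (by omega)]
  by_cases hne : arg p = arg q
  · rw [eq_of_idxOf hp1, eq_of_idxOf hq1, hi, hne]
  · exfalso
    rcases le_total k l with hkl | hkl
    · exact hq2 _ hne (.inr harg) _ (hcode ▸ Code.evaln_mono hkl hp3)
    · exact hp2 _ (Ne.symm hne) (.inl harg) _ (hcode ▸ Code.evaln_mono hkl hq3)

theorem univ_optimal (V : List Bool →. ℕ) (hV : IsPrefixMachine V) :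
    ∃ c : ℕ, ∀ p y, y ∈ V p → ∃ q : List Bool, y ∈ univ q ∧ q.length ≤ p.length + c := by
  obtain ⟨c, hc⟩ := Code.exists_code.1 hV.partrec
  have heval : ∀ (p : List Bool) (y : ℕ), y ∈ c.eval (Encodable.encode p) ↔ y ∈ V p := by
    intro p y
    rw [hc]
    simp
  refine ⟨Encodable.encode c + 1, fun p y hy => ?_⟩
  refine ⟨List.replicate (Encodable.encode c) true ++ false :: p, ?_, by simp; omega⟩
  set P := List.replicate (Encodable.encode c) true ++ false :: p with hP
  have hcode : code P = c := by rw [code, idxOf_replicate]; simp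
  have harg : arg P = p := arg_replicate _ _
  have hlt : P.idxOf false < P.length := by rw [idxOf_replicate]; simp [hP]
  have hbad : ∀ k, ∀ n < k, ¬ Bad c p k n := by
    rintro k n - ⟨h1, h2, h3⟩
    obtain ⟨v, hv⟩ := Option.isSome_iff_exists.1 h3
    have hd : (V (str n)).Dom := Part.dom_iff_mem.2 ⟨v, (heval _ _).1 (Code.evaln_sound hv)⟩
    have hd' : (V p).Dom := Part.dom_iff_mem.2 ⟨y, hy⟩
    rcases h2 with h2 | h2
    · exact h1 (hV.prefixFree _ _ hd' hd ⟨_, h2⟩).symm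
    · exact h1 (hV.prefixFree _ _ hd hd' ⟨_, h2⟩)
  have hstep : ∀ k, step P k = Code.evaln k c (Encodable.encode p) := by
    intro k
    rw [step, hcode, harg, if_pos ⟨hlt, hbad k⟩]
  refine (Nat.rfindOpt_mono ?_).2 ?_
  · intro a m n hmn ha
    rw [hstep] at ha ⊢
    exact Code.evaln_mono hmn ha
  · obtain ⟨k, hk⟩ := Code.evaln_complete.1 ((heval p y).2 hy)
    exact ⟨k, by rwa [hstep]⟩

end PrefixMachine

theorem exists_isOptimalPrefixMachine : ∃ U : List Bool →. ℕ, IsOptimalPrefixMachine U :=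
  ⟨PrefixMachine.univ, PrefixMachine.isPrefixMachine_univ, PrefixMachine.univ_optimal⟩

end

/-!
Choose a rational number `u / v` between `t` and `dim(x)` and put `L = K_n(x)`. Give a dyadic cube
of level `m < n` the capacity `2 ^ (L - u m / v)`, and a cube of level `n` the capacity `1`. Run
through the enumeration of `P` given `w`, and keep a cube if this does not overfill any of its
ancestors, itself included (`GreedyPacking.pack`). The set `P'` of all cubes that are kept respects
the capacities, so a cube of level `m` contains about `2 ^ (L - t m)` elements of `P'` at most, and
everything reduces to the lower bound `|P'| ≥ 2 ^ (L - |w| - O(log n))`.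

When the cube of `x` is examined, it is either kept or rejected; in both cases one of the cubes
around `x`, of some level `m ≤ n`, has its capacity exhausted from then on
(`GreedyPacking.exists_cap_le_load`). Given `n`, `m`, `L` and `w`, the exhausted cubes of level `m`
can be enumerated, and there are at most `|P'| / cap` of them, where `cap` is the capacity. Hence
such a cube is described by `w`, its position in the enumeration and `O(log n)` further bits
(`BoundedEnumeration.exists_kolmogorov_le`, `DyadicCube.exists_kolmogorov_saturated_le`), so that
`K_m(x) ≤ |w| + log (|P'| / cap) + O(log n)`. As `K_m(x) ≥ u m / v - O(1)` for `m < n`, and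
`K_n(x) = L`, the sum of `K_m(x)` and `log cap` is at least `L - O(1)` in each case, which is the
lower bound (`DyadicCube.eventually_exists_packing`).

The set `P'` itself need not contain the cube of `x`. The errors are `O(log n)` only, so the factor
`ε⁻¹` in the theorem is used just to have `O(log n) ≤ c ε⁻¹ log n`, and the term `c ε n` to absorb
`O(log n)` for large `n`. The description of `w` needs its length, which is harmless as long as
`|w| ≤ K_n(x)`; for longer `w`, a single cube is large enough (`isDyadicSet_singleton`).
-/

/-! ### Counting bounds for Kolmogorov complexity -/

namespace BoundedEnumeration

open PrefixMachine (arg primrec_arg)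

/-- The natural number with the given binary digits, most significant digit first. -/
def binVal (l : List Bool) : ℕ := l.foldl (fun v b => 2 * v + b.toNat) 0

theorem primrec_binVal : Primrec binVal :=
  Primrec.list_foldl .id (.const 0) (Primrec.nat_add.comp
    (Primrec.nat_mul.comp (.const 2) (Primrec.fst.comp .snd))
    ((Primrec.dom_finite Bool.toNat).comp (Primrec.snd.comp .snd))).to₂

theorem exists_binVal_eq (s : ℕ) :
    ∀ k < 2 ^ s, ∃ l : List Bool, l.length = s ∧ binVal l = k := by
  induction s with
  | zero => intro k hk; exact ⟨[], rfl, by simp [binVal]; omega⟩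
  | succ s ih =>
    intro k hk
    obtain ⟨l, hl, hv⟩ := ih (k / 2) (by rw [pow_succ] at hk; omega)
    refine ⟨l ++ [decide (k % 2 = 1)], by simp [hl], ?_⟩
    unfold binVal at hv ⊢
    rw [List.foldl_append, hv]
    rcases Nat.mod_two_eq_zero_or_one k with h | h <;> simp [h] <;> omega

variable {α β : Type*}

/-- The values listed by `f` before stage `t`, without repetitions, in the order of their first
appearance. -/
def distinct [DecidableEq α] (f : ℕ → Option α) (t : ℕ) : List α :=
  t.rec [] fun i l => (f i).elim l fun a => if a ∈ l then l else l ++ [a]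

theorem primrec_option_elim {γ σ : Type*} [Primcodable α] [Primcodable γ] [Primcodable σ]
    {o : γ → Option α} {f : γ → σ} {g : γ → α → σ} (ho : Primrec o) (hf : Primrec f)
    (hg : Primrec₂ g) : Primrec fun z => (o z).elim (f z) (g z) :=
  (Primrec.option_casesOn ho hf hg).of_eq fun z => by cases o z <;> rfl

theorem primrec_distinct {γ : Type*} [Primcodable α] [Primcodable γ] [DecidableEq α]
    {f : γ → ℕ → Option α} (hf : Primrec₂ f) : Primrec₂ fun z t => distinct (f z) t := by
  have hmem : PrimrecRel fun (l : List α) (a : α) => a ∈ l :=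
    (PrimrecRel.exists_mem_list (R := fun x a : α => x = a) Primrec.eq).of_eq
      fun l a => by simp
  have h : Primrec fun q : γ × ℕ × List α => (f q.1 q.2.1).elim q.2.2
      fun a => if a ∈ q.2.2 then q.2.2 else q.2.2 ++ [a] := by
    refine primrec_option_elim (hf.comp .fst (Primrec.fst.comp .snd)) (Primrec.snd.comp .snd) ?_
    have hl : Primrec fun q : (γ × ℕ × List α) × α => q.1.2.2 :=
      Primrec.snd.comp (Primrec.snd.comp .fst)
    exact Primrec.ite (hmem.comp hl .snd) hl (Primrec.list_concat.comp hl .snd)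
  exact Primrec.nat_rec (.const []) h.to₂

section distinct

variable [DecidableEq α] (f : ℕ → Option α)

theorem distinct_succ (t : ℕ) : distinct f (t + 1) =
    (f t).elim (distinct f t) fun a =>
      if a ∈ distinct f t then distinct f t else distinct f t ++ [a] := rfl

theorem distinct_prefix_succ (t : ℕ) : distinct f t <+: distinct f (t + 1) := by
  rw [distinct_succ]
  cases f t with
  | none => simp
  | some a => simp only [Option.elim_some]; split_ifs <;> simp

theorem distinct_prefix {s t : ℕ} (h : s ≤ t) : distinct f s <+: distinct f t := by
  induction t, h using Nat.le_induction with
  | base => exact List.prefix_rfl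
  | succ t _ ih => exact ih.trans (distinct_prefix_succ f t)

theorem nodup_distinct (t : ℕ) : (distinct f t).Nodup := by
  induction t with
  | zero => exact List.nodup_nil
  | succ t ih =>
    rw [distinct_succ]
    cases f t with
    | none => exact ih
    | some a =>
      simp only [Option.elim_some]
      split_ifs with h
      · exact ih
      · simpa using ih.concat h

theorem exists_of_mem_distinct {t : ℕ} {a : α} (h : a ∈ distinct f t) : ∃ i, f i = some a := by
  induction t with
  | zero => simp [distinct] at h
  | succ t ih =>
    rw [distinct_succ] at h
    cases hb : f t with
    | none => exact ih (by simpa [hb] using h)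
    | some b =>
      simp only [hb, Option.elim_some] at h
      split_ifs at h with hm
      · exact ih h
      · rcases List.mem_append.1 h with h | h
        · exact ih h
        · exact ⟨t, by simpa using hb.trans (congrArg some (List.mem_singleton.1 h).symm)⟩

theorem mem_distinct {t : ℕ} {a : α} (h : f t = some a) : a ∈ distinct f (t + 1) := by
  rw [distinct_succ, h, Option.elim_some]
  split_ifs with hm
  · exact hm
  · simp

end distinct

/-- Every computably enumerable relation is listed by a primitive recursive function. -/
theorem exists_primrec_enumeration {α γ : Type*} [Primcodable α] [Primcodable γ] {R : γ → α → Prop}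
    (hR : REPred fun z : γ × α => R z.1 z.2) :
    ∃ f : γ → ℕ → Option α, Primrec₂ f ∧ ∀ z a, R z a ↔ ∃ i, f z i = some a := by
  obtain ⟨c, hc⟩ := Nat.Partrec.Code.exists_code.1 hR
  have hdom : ∀ z a, R z a ↔ ∃ t,
      (Nat.Partrec.Code.evaln t c (Encodable.encode (z, a))).isSome = true := by
    intro z a
    have h1 : R z a ↔ (c.eval (Encodable.encode (z, a))).Dom := by
      rw [hc]
      simp [Part.assert]
    rw [h1, Part.dom_iff_mem]
    simp only [Nat.Partrec.Code.evaln_complete, Option.isSome_iff_exists, Option.mem_def]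
    exact exists_comm
  refine ⟨fun z i => (Encodable.decode (α := α) i.unpair.2).bind fun a =>
    if (Nat.Partrec.Code.evaln i.unpair.1 c (Encodable.encode (z, a))).isSome = true
      then some a else none, ?_, fun z a => ?_⟩
  · have hu : Primrec fun q : γ × ℕ => q.2.unpair := Primrec.unpair.comp .snd
    refine Primrec.option_bind (Primrec.decode.comp (Primrec.snd.comp hu)) ?_
    refine Primrec.ite ?_ (Primrec.option_some.comp .snd) (.const none)
    refine Primrec.eq.comp (Primrec.option_isSome.comp (Nat.Partrec.Code.primrec_evaln.comp
      (((Primrec.fst.comp (hu.comp .fst)).pair (.const c)).pair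
        (Primrec.encode.comp ((Primrec.fst.comp .fst).pair .snd))))) (.const true)
  · rw [hdom]
    constructor
    · rintro ⟨t, ht⟩
      exact ⟨Nat.pair t (Encodable.encode a), by
        dsimp only
        rw [Nat.unpair_pair, Encodable.encodek]
        exact if_pos ht⟩
    · rintro ⟨i, hi⟩
      obtain ⟨b, -, hb⟩ := Option.bind_eq_some_iff.1 hi
      split_ifs at hb with h
      · cases hb
        exact ⟨_, h⟩

variable [Primcodable α] [Primcodable β] [DecidableEq α]

/-- `t` steps of the machine that decodes positions in an enumeration. A program
`1^s 0 b w v` with `|b| = s` consists of a number `b = ⟨k, ⟨|w|, |v|⟩⟩` in binary notation, the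
auxiliary string `w`, and a position `v`, in binary notation, in the list of distinct values of
`f (k, w)`; the output is the value of `g` at this position. -/
def decodeStep (f : ℕ × List Bool → ℕ → Option α) (g : α → β) (p : List Bool) (t : ℕ) :
    Option ℕ :=
  if p.idxOf false < p.length ∧ (arg p).length = p.idxOf false +
      ((binVal ((arg p).take (p.idxOf false))).unpair.2.unpair.1 +
        (binVal ((arg p).take (p.idxOf false))).unpair.2.unpair.2) then
    ((distinct (f ((binVal ((arg p).take (p.idxOf false))).unpair.1,
        ((arg p).drop (p.idxOf false)).take
          (binVal ((arg p).take (p.idxOf false))).unpair.2.unpair.1)) t)[binVal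
        (((arg p).drop (p.idxOf false)).drop
          (binVal ((arg p).take (p.idxOf false))).unpair.2.unpair.1)]?).map
      fun a => Encodable.encode (g a)
  else none

theorem primrec_decodeStep {f : ℕ × List Bool → ℕ → Option α} (hf : Primrec₂ f) {g : α → β}
    (hg : Primrec g) : Primrec₂ (decodeStep f g) := by
  have hp : Primrec fun z : List Bool × ℕ => z.1 := .fst
  have hs : Primrec fun z : List Bool × ℕ => z.1.idxOf false :=
    Primrec.list_idxOf.comp (.const false) hp
  have ha : Primrec fun z : List Bool × ℕ => arg z.1 := primrec_arg.comp hp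
  have hk : Primrec fun z : List Bool × ℕ => binVal ((arg z.1).take (z.1.idxOf false)) :=
    primrec_binVal.comp (Primrec.list_take.comp hs ha)
  have hk1 := Primrec.fst.comp (Primrec.unpair.comp hk)
  have hk2 := Primrec.unpair.comp (Primrec.snd.comp (Primrec.unpair.comp hk))
  have hu := Primrec.list_drop.comp hs ha
  have hd := (primrec_distinct hf).comp
    (hk1.pair (Primrec.list_take.comp (Primrec.fst.comp hk2) hu)) (Primrec.snd (α := List Bool))
  have hi := primrec_binVal.comp (Primrec.list_drop.comp (Primrec.fst.comp hk2) hu)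
  refine Primrec.ite ((Primrec.nat_lt.comp hs (Primrec.list_length.comp hp)).and
    (Primrec.eq.comp (Primrec.list_length.comp ha) (Primrec.nat_add.comp hs
      (Primrec.nat_add.comp (Primrec.fst.comp hk2) (Primrec.snd.comp hk2))))) ?_ (.const none)
  exact Primrec.option_map (Primrec.list_getElem?.comp hd hi)
    (Primrec.encode.comp (hg.comp Primrec.snd)).to₂

theorem isPrefixMachine_decode {f : ℕ × List Bool → ℕ → Option α} (hf : Primrec₂ f) {g : α → β}
    (hg : Primrec g) : IsPrefixMachine fun p => Nat.rfindOpt (decodeStep f g p) := by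
  refine ⟨Partrec.rfindOpt (primrec_decodeStep hf hg).to_comp, fun p q hp hq hpq => ?_⟩
  have key : ∀ p, (Nat.rfindOpt (decodeStep f g p)).Dom → p.idxOf false < p.length ∧
      (arg p).length = p.idxOf false +
        ((binVal ((arg p).take (p.idxOf false))).unpair.2.unpair.1 +
          (binVal ((arg p).take (p.idxOf false))).unpair.2.unpair.2) := by
    intro p hp
    obtain ⟨t, y, hy⟩ := Nat.rfindOpt_dom.1 hp
    unfold decodeStep at hy
    split_ifs at hy with h
    · exact h
    · simp at hy
  obtain ⟨hp1, hp2⟩ := key p hp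
  obtain ⟨hq1, hq2⟩ := key q hq
  have hi := PrefixMachine.idxOf_eq_of_prefix hp1 hpq
  have harg : arg p <+: arg q := by
    obtain ⟨r, rfl⟩ := hpq
    refine ⟨r, ?_⟩
    rw [arg, arg, ← hi, List.drop_append_of_le_length (by omega)]
  have htake : (arg p).take (p.idxOf false) = (arg q).take (q.idxOf false) := by
    obtain ⟨r, hr⟩ := harg
    rw [← hi, ← hr, List.take_append_of_le_length (by omega)]
  have hlen : (arg p).length = (arg q).length := by rw [hp2, hq2, htake, hi]
  rw [PrefixMachine.eq_of_idxOf hp1, PrefixMachine.eq_of_idxOf hq1, hi,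
    harg.eq_of_length hlen]

theorem kolmogorov_le_of_mem {U : List Bool →. ℕ} {b : β} {q : List Bool}
    (h : Encodable.encode b ∈ U q) : kolmogorov U b ≤ q.length :=
  Nat.sInf_le ⟨q, h, rfl⟩

/-- Counting bound: if `f` uniformly enumerates, given `k` and a string `w`, at most `2 ^ l`
objects, then each of them is determined by `w`, its position, and the number `⟨k, ⟨|w|, l⟩⟩`, which
takes `2 s` further bits in self-delimiting form. -/
theorem exists_kolmogorov_le {U : List Bool →. ℕ} (hU : IsOptimalPrefixMachine U)
    {f : ℕ × List Bool → ℕ → Option α} (hf : Primrec₂ f) {g : α → β} (hg : Primrec g) :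
    ∃ c : ℕ, ∀ (k : ℕ) (w : List Bool) (l s i : ℕ) (a : α), f (k, w) i = some a →
      (∀ A : Finset α, (∀ b ∈ A, ∃ j, f (k, w) j = some b) → A.card ≤ 2 ^ l) →
      Nat.pair k (Nat.pair w.length l) < 2 ^ s →
      kolmogorov U (g a) ≤ w.length + l + 2 * s + c := by
  obtain ⟨c, hc⟩ := hU.optimal _ (isPrefixMachine_decode hf hg)
  refine ⟨c + 1, fun k w l s i a ha hA hs => ?_⟩
  obtain ⟨b, hb, hbv⟩ := exists_binVal_eq s _ hs
  obtain ⟨r, hr, hra⟩ := List.getElem_of_mem (mem_distinct _ ha)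
  have hr2 : r < 2 ^ l := hr.trans_le <| by
    rw [← List.toFinset_card_of_nodup (nodup_distinct _ _)]
    exact hA _ fun b hb => exists_of_mem_distinct _ (List.mem_toFinset.1 hb)
  obtain ⟨v, hv, hvv⟩ := exists_binVal_eq l r hr2
  set p := List.replicate s true ++ false :: (b ++ (w ++ v)) with hp
  have hidx : p.idxOf false = s := PrefixMachine.idxOf_replicate _ _
  have harg : arg p = b ++ (w ++ v) := PrefixMachine.arg_replicate _ _
  have hstep : ∀ t, decodeStep f g p t =
      ((distinct (f (k, w)) t)[r]?).map fun a => Encodable.encode (g a) := by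
    intro t
    have h1 : (b ++ (w ++ v)).take s = b := by rw [← hb, List.take_left]
    have h2 : (b ++ (w ++ v)).drop s = w ++ v := by rw [← hb, List.drop_left]
    have hlen : p.length = s + (s + (w.length + l) + 1) := by simp [hp, hb, hv]
    rw [decodeStep, hidx, harg, h1, h2, hbv, if_pos ⟨by omega, by simp [hb, hv]⟩]
    simp [hvv]
  obtain ⟨q, hq, hql⟩ := hc p (Encodable.encode (g a)) <| by
    refine (Nat.rfindOpt_mono ?_).2 ⟨i + 1, ?_⟩
    · intro y m n hmn hy
      rw [hstep, Option.mem_def, Option.map_eq_some_iff] at hy ⊢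
      obtain ⟨a, ha, hy⟩ := hy
      refine ⟨a, ?_, hy⟩
      obtain ⟨z, hz⟩ := distinct_prefix (f (k, w)) hmn
      rw [← hz, List.getElem?_append_left (List.getElem?_eq_some_iff.1 ha).1, ha]
    · rw [hstep, List.getElem?_eq_getElem hr, hra]
      rfl
  have := kolmogorov_le_of_mem hq
  have hlen : p.length = s + (s + (w.length + l) + 1) := by simp [hp, hb, hv]
  omega

end BoundedEnumeration

/-! ### Greedy packing under a family of capacities -/

namespace GreedyPacking

variable {α β : Type*} [DecidableEq β]

/-- The number of entries of the list `G` whose image under `proj d` is `r`. -/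
def load (proj : ℕ → α → β) (d : ℕ) (r : β) (G : List α) : ℕ :=
  (G.filter fun q => decide (proj d q = r)).length

/-- The greedy selection: the objects listed by `f` before stage `t` are examined one after the
other, and `a` is kept if for each `d ≤ n` fewer than `cap d` objects kept so far have the same
image as `a` under `proj d`. The most recent object comes first. -/
def pack (proj : ℕ → α → β) (f : ℕ → Option α) (n : ℕ) (cap : ℕ → ℕ) (t : ℕ) : List α :=
  t.rec [] fun i G => (f i).elim G fun a =>
    if ∀ d < n + 1, load proj d (proj d a) G < cap d then a :: G else G

variable (proj : ℕ → α → β) (f : ℕ → Option α) (n : ℕ) (cap : ℕ → ℕ)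

theorem pack_succ (t : ℕ) : pack proj f n cap (t + 1) =
    (f t).elim (pack proj f n cap t) fun a =>
      if ∀ d < n + 1, load proj d (proj d a) (pack proj f n cap t) < cap d
        then a :: pack proj f n cap t else pack proj f n cap t := rfl

theorem load_cons (d : ℕ) (r : β) (a : α) (G : List α) :
    load proj d r (a :: G) = load proj d r G + if proj d a = r then 1 else 0 := by
  unfold load
  rw [List.filter_cons]
  split_ifs <;> simp_all

variable {proj} in
theorem load_le_of_suffix {G H : List α} (h : G <:+ H) (d : ℕ) (r : β) :
    load proj d r G ≤ load proj d r H :=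
  (h.filter _).length_le

theorem pack_suffix_succ (t : ℕ) : pack proj f n cap t <:+ pack proj f n cap (t + 1) := by
  rw [pack_succ]
  cases f t with
  | none => simp
  | some a => simp only [Option.elim_some]; split_ifs <;> simp

theorem pack_suffix {s t : ℕ} (h : s ≤ t) : pack proj f n cap s <:+ pack proj f n cap t := by
  induction t, h using Nat.le_induction with
  | base => exact List.suffix_rfl
  | succ t _ ih => exact ih.trans (pack_suffix_succ ..)

theorem exists_of_mem_pack {t : ℕ} {a : α} (h : a ∈ pack proj f n cap t) :
    ∃ i, f i = some a := by
  induction t with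
  | zero => simp [pack] at h
  | succ t ih =>
    rw [pack_succ] at h
    cases hb : f t with
    | none => exact ih (by simpa [hb] using h)
    | some b =>
      simp only [hb, Option.elim_some] at h
      split_ifs at h with hm
      · rcases List.mem_cons.1 h with rfl | h
        · exact ⟨t, hb⟩
        · exact ih h
      · exact ih h

theorem load_pack_le (t : ℕ) {d : ℕ} (hd : d ≤ n) (r : β) :
    load proj d r (pack proj f n cap t) ≤ cap d := by
  induction t with
  | zero => simp [pack, load]
  | succ t ih =>
    rw [pack_succ]
    cases f t with
    | none => exact ih
    | some a =>
      simp only [Option.elim_some]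
      split_ifs with h
      · rw [load_cons]
        split_ifs with hr
        · exact hr ▸ h d (by omega)
        · exact ih
      · exact ih

/-- Each examined object has an image whose capacity is exhausted: an object that is kept exhausts
`cap 0 = 1`, and an object that is rejected meets an exhausted capacity. -/
theorem exists_cap_le_load (h0 : cap 0 ≤ 1) {t : ℕ} {a : α} (h : f t = some a) :
    ∃ d ≤ n, cap d ≤ load proj d (proj d a) (pack proj f n cap (t + 1)) := by
  rw [pack_succ, h, Option.elim_some]
  split_ifs with hk
  · exact ⟨0, by omega, by rw [load_cons, if_pos rfl]; omega⟩
  · push Not at hk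
    obtain ⟨d, hd, hle⟩ := hk
    exact ⟨d, by omega, hle⟩

theorem nodup_pack (h0 : cap 0 ≤ 1) (t : ℕ) :
    (pack proj f n cap t).Nodup := by
  induction t with
  | zero => exact List.nodup_nil
  | succ t ih =>
    rw [pack_succ]
    cases f t with
    | none => exact ih
    | some a =>
      simp only [Option.elim_some]
      split_ifs with h
      · refine List.nodup_cons.2 ⟨fun ha => ?_, ih⟩
        have h1 : load proj 0 (proj 0 a) (pack proj f n cap t) = 0 := by
          have := h 0 (by omega)
          omega
        rw [load, List.length_eq_zero_iff, List.filter_eq_nil_iff] at h1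
        simpa using h1 a ha
      · exact ih

/-- Objects are kept finitely often if `f` lists finitely many objects. -/
theorem exists_forall_pack_suffix (h0 : cap 0 ≤ 1)
    {P : Finset α} (hP : ∀ i a, f i = some a → a ∈ P) :
    ∃ T, ∀ t, pack proj f n cap t <:+ pack proj f n cap T := by
  classical
  have hbd : BddAbove (Set.range fun t => (pack proj f n cap t).length) := by
    refine ⟨P.card, ?_⟩
    rintro _ ⟨t, rfl⟩
    change (pack proj f n cap t).length ≤ _
    rw [← List.toFinset_card_of_nodup (nodup_pack proj f n cap h0 t)]
    refine Finset.card_le_card fun a ha => ?_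
    obtain ⟨i, hi⟩ := exists_of_mem_pack proj f n cap (List.mem_toFinset.1 ha)
    exact hP i a hi
  obtain ⟨T, hT⟩ := Nat.sSup_mem (Set.range_nonempty _) hbd
  refine ⟨T, fun t => ?_⟩
  rcases le_total t T with h | h
  · exact pack_suffix _ _ _ _ h
  · have hlen : (pack proj f n cap t).length ≤ (pack proj f n cap T).length := by
      change (fun t => (pack proj f n cap t).length) t ≤ (fun t => (pack proj f n cap t).length) T
      rw [hT]
      exact le_csSup hbd ⟨t, rfl⟩
    rw [(pack_suffix proj f n cap h).eq_of_length_le hlen]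

theorem sum_load_le (d : ℕ) (A : Finset β) (G : List α) :
    ∑ r ∈ A, load proj d r G ≤ G.length := by
  induction G with
  | nil => simp [load]
  | cons a G ih =>
    simp only [load_cons, Finset.sum_add_distrib, Finset.sum_ite_eq, List.length_cons]
    split_ifs <;> omega

theorem card_mul_cap_le {d : ℕ} {A : Finset β} {G : List α}
    (h : ∀ r ∈ A, cap d ≤ load proj d r G) : A.card * cap d ≤ G.length := by
  rw [← smul_eq_mul]
  exact (Finset.card_nsmul_le_sum A _ _ h).trans (sum_load_le proj d A G)

variable {proj} [Primcodable α] [Primcodable β]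

theorem primrec_load (hproj : Primrec₂ proj) :
    Primrec₂ fun (z : ℕ × β) (G : List α) => load proj z.1 z.2 G := by
  have h : PrimrecRel fun (q : α) (z : ℕ × β) => proj z.1 q = z.2 :=
    Primrec.eq.comp (hproj.comp (Primrec.fst.comp .snd) .fst) (Primrec.snd.comp .snd)
  exact Primrec.list_length.comp (h.listFilter.comp .snd .fst)

theorem primrec_pack (hproj : Primrec₂ proj) {γ : Type*} [Primcodable γ]
    {f : γ → ℕ → Option α} (hf : Primrec₂ f) {n : γ → ℕ} (hn : Primrec n) {cap : γ → ℕ → ℕ}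
    (hcap : Primrec₂ cap) : Primrec₂ fun z t => pack proj (f z) (n z) (cap z) t := by
  have h : Primrec fun q : γ × ℕ × List α => (f q.1 q.2.1).elim q.2.2 fun a =>
      if ∀ d < n q.1 + 1, load proj d (proj d a) q.2.2 < cap q.1 d then a :: q.2.2 else q.2.2 := by
    refine BoundedEnumeration.primrec_option_elim (hf.comp .fst (Primrec.fst.comp .snd))
      (Primrec.snd.comp .snd) ?_
    have hG : Primrec fun q : (γ × ℕ × List α) × α => q.1.2.2 :=
      Primrec.snd.comp (Primrec.snd.comp .fst)
    have hr : PrimrecRel fun (d : ℕ) (q : (γ × ℕ × List α) × α) =>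
        load proj d (proj d q.2) q.1.2.2 < cap q.1.1 d :=
      Primrec.nat_lt.comp ((primrec_load hproj).comp
        (Primrec.fst.pair (hproj.comp .fst (Primrec.snd.comp .snd))) (hG.comp .snd))
        (hcap.comp (Primrec.fst.comp (Primrec.fst.comp .snd)) .fst)
    have hn' : Primrec fun q : (γ × ℕ × List α) × α => List.range (n q.1.1 + 1) :=
      Primrec.list_range.comp (Primrec.succ.comp (hn.comp (Primrec.fst.comp .fst)))
    have hall : PrimrecPred fun q : (γ × ℕ × List α) × α =>
        ∀ d < n q.1.1 + 1, load proj d (proj d q.2) q.1.2.2 < cap q.1.1 d :=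
      (hr.forall_mem_list.comp hn' .id).of_eq fun q => by simp only [List.mem_range, id]
    exact Primrec.ite hall (Primrec.list_cons.comp .snd hG) hG
  exact Primrec.nat_rec (.const []) h.to₂

end GreedyPacking

/-! ### Dyadic cubes with natural coordinates -/

namespace DyadicCube

/-- The dyadic cube with natural coordinates; every cube in the unit square is of this form. -/
def ofNat (q : ℕ × ℕ × ℕ) : DyadicCube := (q.1, (q.2.1 : ℤ), (q.2.2 : ℤ))

/-- The coordinates of the dyadic cube `d` levels above the one with coordinates `q`. -/
def ancestor (d : ℕ) (q : ℕ × ℕ) : ℕ × ℕ := (q.1 / 2 ^ d, q.2 / 2 ^ d)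

theorem primrec_intOfNat : Primrec fun n : ℕ => (n : ℤ) :=
  ((Primrec.ofNat ℤ).comp (Primrec.nat_mul.comp (.const 2) .id)).of_eq fun n => by
    rw [← Denumerable.ofNat_encode (n : ℤ)]
    rfl

theorem primrec_ofNat : Primrec ofNat :=
  Primrec.fst.pair ((primrec_intOfNat.comp (Primrec.fst.comp .snd)).pair
    (primrec_intOfNat.comp (Primrec.snd.comp .snd)))

theorem primrec_two_pow : Primrec fun n : ℕ => 2 ^ n := by
  have h : Primrec (Nat.rec 1 fun _ v => 2 * v : ℕ → ℕ) :=
    Primrec.nat_rec₁ 1 (Primrec.nat_mul.comp (.const 2) .snd).to₂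
  refine h.of_eq fun n => ?_
  induction n with
  | zero => rfl
  | succ n ih => rw [pow_succ, ← ih]; exact mul_comm _ _

theorem primrec_ancestor : Primrec₂ ancestor := by
  have h2 : Primrec fun z : ℕ × ℕ × ℕ => 2 ^ z.1 := primrec_two_pow.comp .fst
  exact (Primrec.nat_div.comp (Primrec.fst.comp .snd) h2).pair
    (Primrec.nat_div.comp (Primrec.snd.comp .snd) h2)

theorem floor_two_pow_mul {m n : ℕ} (h : m ≤ n) (a : ℝ) :
    ⌊(2 : ℝ) ^ m * a⌋ = ⌊(2 : ℝ) ^ n * a⌋ / 2 ^ (n - m) := by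
  have h1 : (2 : ℝ) ^ m * a = (2 : ℝ) ^ n * a / ((2 ^ (n - m) : ℕ) : ℝ) := by
    have : (2 : ℝ) ^ n = 2 ^ m * 2 ^ (n - m) := by rw [← pow_add]; congr 1; omega
    rw [this]
    push_cast
    field_simp
  rw [h1, Int.floor_div_natCast]
  push_cast
  rfl

theorem containing_eq_ancestor {m n : ℕ} (h : m ≤ n) {x : EuclideanSpace ℝ (Fin 2)} {q : ℕ × ℕ}
    (hx : containing n x = ofNat (n, q)) : containing m x = ofNat (m, ancestor (n - m) q) := by
  simp only [containing, ofNat, ancestor, Prod.mk.injEq, true_and] at hx ⊢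
  rw [floor_two_pow_mul h, floor_two_pow_mul h, hx.1, hx.2]
  push_cast
  exact ⟨rfl, rfl⟩

/-- The lower left corner of a dyadic cube. -/
noncomputable def corner (Q : DyadicCube) : EuclideanSpace ℝ (Fin 2) :=
  !₂[(Q.2.1 : ℝ) / 2 ^ Q.level, (Q.2.2 : ℝ) / 2 ^ Q.level]

theorem containing_corner (Q : DyadicCube) : containing Q.level Q.corner = Q := by
  obtain ⟨n, i, j⟩ := Q
  have h : ∀ i : ℤ, ⌊(2 : ℝ) ^ n * ((i : ℝ) / 2 ^ n)⌋ = i := fun i => by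
    rw [mul_div_cancel₀ _ (by positivity), Int.floor_intCast]
  simp [containing, corner, level, h]

theorem corner_mem (Q : DyadicCube) : Q.corner ∈ Q.toSet :=
  (mem_toSet_iff _ _).2 (containing_corner Q).symm

theorem eq_ancestor_of_subset {n : ℕ} {q : ℕ × ℕ} {R : DyadicCube} (hR : R.level ≤ n)
    (h : (ofNat (n, q)).toSet ⊆ R.toSet) : R = ofNat (R.level, ancestor (n - R.level) q) := by
  have h1 := (mem_toSet_iff _ _).1 (h (corner_mem _))
  exact h1.trans (containing_eq_ancestor hR (containing_corner (ofNat (n, q))))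

theorem exists_ofNat_of_mem_family {n : ℕ} {Q : DyadicCube} (h : Q ∈ family n) :
    ∃ q : ℕ × ℕ, Q = ofNat (n, q) ∧ q.1 < 2 ^ (n + 1) ∧ q.2 < 2 ^ (n + 1) := by
  obtain ⟨n', i, j⟩ := Q
  obtain ⟨hn, hk⟩ := h
  obtain rfl : n' = n := hn
  have key : ∀ i : ℤ, 0 ≤ (i : ℝ) / 2 ^ n' ∧ (i : ℝ) / 2 ^ n' ≤ 1 →
      ∃ a : ℕ, i = (a : ℤ) ∧ a < 2 ^ (n' + 1) := by
    rintro i ⟨h0, h1⟩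
    have h2 : (0 : ℝ) < 2 ^ n' := by positivity
    rw [le_div_iff₀ h2, zero_mul] at h0
    rw [div_le_one h2] at h1
    obtain ⟨a, rfl⟩ := Int.eq_ofNat_of_zero_le (by exact_mod_cast h0 : 0 ≤ i)
    refine ⟨a, rfl, ?_⟩
    have h1' : a ≤ 2 ^ n' := by exact_mod_cast h1
    rw [pow_succ]
    have := Nat.pow_pos (n := n') two_pos
    omega
  have hc := hk _ (corner_mem _)
  obtain ⟨a, rfl, ha⟩ := key i (by simpa [corner, level] using hc 0)
  obtain ⟨b, rfl, hb⟩ := key j (by simpa [corner, level] using hc 1)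
  exact ⟨(a, b), rfl, ha, hb⟩

theorem ofNat_injective : Function.Injective ofNat := by
  rintro ⟨n, i, j⟩ ⟨n', i', j'⟩ h
  simpa [ofNat] using h

end DyadicCube

/-! ### Complexity of the cubes with exhausted capacity -/

namespace DyadicCube

open GreedyPacking BoundedEnumeration

/-- The cubes of level `n - d` whose capacity is exhausted in the greedy packing of the cubes of
level `n` listed by `f`. A cube is listed whenever a cube below it is examined while its capacity is
exhausted. -/
def saturated (f : ℕ → Option (ℕ × ℕ)) (cap : ℕ → ℕ) (n d i : ℕ) : Option (ℕ × ℕ × ℕ) :=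
  (f i).bind fun q => if cap d ≤ load ancestor d (ancestor d q) (pack ancestor f n cap (i + 1)) then
    some (n - d, ancestor d q) else none

theorem primrec_saturated {γ : Type*} [Primcodable γ] {f : γ → ℕ → Option (ℕ × ℕ)}
    (hf : Primrec₂ f) {cap : γ → ℕ → ℕ} (hcap : Primrec₂ cap) {n d : γ → ℕ} (hn : Primrec n)
    (hd : Primrec d) : Primrec₂ fun z i => saturated (f z) (cap z) (n z) (d z) i := by
  have hz : Primrec fun y : (γ × ℕ) × (ℕ × ℕ) => y.1.1 := Primrec.fst.comp .fst
  have hdz : Primrec fun y : (γ × ℕ) × (ℕ × ℕ) => d y.1.1 := hd.comp hz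
  have hanc : Primrec fun y : (γ × ℕ) × (ℕ × ℕ) => ancestor (d y.1.1) y.2 :=
    primrec_ancestor.comp hdz .snd
  have hpack : Primrec fun y : (γ × ℕ) × (ℕ × ℕ) =>
      pack ancestor (f y.1.1) (n y.1.1) (cap y.1.1) (y.1.2 + 1) :=
    (primrec_pack primrec_ancestor hf hn hcap).comp hz
      (Primrec.succ.comp (Primrec.snd.comp .fst))
  have hload : Primrec fun y : (γ × ℕ) × (ℕ × ℕ) => load ancestor (d y.1.1)
      (ancestor (d y.1.1) y.2) (pack ancestor (f y.1.1) (n y.1.1) (cap y.1.1) (y.1.2 + 1)) :=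
    (primrec_load primrec_ancestor).comp (hdz.pair hanc) hpack
  exact Primrec.option_bind hf (Primrec.ite (Primrec.nat_le.comp (hcap.comp hz hdz) hload)
    (Primrec.option_some.comp ((Primrec.nat_sub.comp (hn.comp hz) hdz).pair hanc))
    (.const none)).to₂

/-- Each saturated cube of level `m` holds `cap` of the selected cubes, so there are few of them,
and they have small complexity. -/
theorem exists_kolmogorov_saturated_le {U : List Bool →. ℕ} (hU : IsOptimalPrefixMachine U)
    {f : ℕ × List Bool → ℕ → Option (ℕ × ℕ)} (hf : Primrec₂ f) {cap : ℕ × ℕ → ℕ → ℕ}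
    (hcap : Primrec₂ cap) (hpos : ∀ z d, 0 < cap z d) :
    ∃ c : ℕ, ∀ (n d L l s i T : ℕ) (w : List Bool) (q : ℕ × ℕ), d ≤ n → f (n, w) i = some q →
      cap (n, L) d ≤ load ancestor d (ancestor d q)
        (pack ancestor (f (n, w)) n (cap (n, L)) (i + 1)) →
      (∀ t, pack ancestor (f (n, w)) n (cap (n, L)) t <:+
        pack ancestor (f (n, w)) n (cap (n, L)) T) →
      (pack ancestor (f (n, w)) n (cap (n, L)) T).length ≤ 2 ^ l * cap (n, L) d →
      Nat.pair (Nat.pair n (Nat.pair d L)) (Nat.pair w.length l) < 2 ^ s →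
      kolmogorov U (ofNat (n - d, ancestor d q)) ≤ w.length + l + 2 * s + c := by
  -- the parameters `n`, `d` and `L` are coded by the number `⟨n, ⟨d, L⟩⟩`
  have hu : Primrec fun z : ℕ × List Bool => z.1.unpair := Primrec.unpair.comp .fst
  have hn : Primrec fun z : ℕ × List Bool => z.1.unpair.1 := Primrec.fst.comp hu
  have hu2 : Primrec fun z : ℕ × List Bool => z.1.unpair.2.unpair :=
    Primrec.unpair.comp (Primrec.snd.comp hu)
  have hf' : Primrec₂ fun (z : ℕ × List Bool) i => f (z.1.unpair.1, z.2) i :=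
    hf.comp ((hn.comp .fst).pair (Primrec.snd.comp .fst)) .snd
  have hcap' : Primrec₂ fun (z : ℕ × List Bool) d =>
      cap (z.1.unpair.1, z.1.unpair.2.unpair.2) d :=
    hcap.comp ((hn.comp .fst).pair (Primrec.snd.comp (hu2.comp .fst))) .snd
  obtain ⟨c, hc⟩ := exists_kolmogorov_le hU
    (primrec_saturated hf' hcap' hn (Primrec.fst.comp hu2)) primrec_ofNat
  refine ⟨c, fun n d L l s i T w q hd hq hsat hT hlen hs => ?_⟩
  refine hc _ w l s i _ (by simp [saturated, hq, hsat]) (fun A hA => ?_) hs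
  have hA' : ∀ b ∈ A, b.1 = n - d ∧ cap (n, L) d ≤ load ancestor d b.2
      (pack ancestor (f (n, w)) n (cap (n, L)) T) := by
    intro b hb
    obtain ⟨j, hj⟩ := hA b hb
    simp only [saturated, Nat.unpair_pair, Option.bind_eq_some_iff,
      Option.ite_none_right_eq_some, Option.some.injEq] at hj
    obtain ⟨r, -, hr, rfl⟩ := hj
    exact ⟨rfl, hr.trans (load_le_of_suffix (hT _) _ _)⟩
  have hinj : Set.InjOn Prod.snd (A : Set (ℕ × ℕ × ℕ)) := fun a ha b hb h =>
    Prod.ext ((hA' a ha).1.trans (hA' b hb).1.symm) h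
  rw [← Finset.card_image_of_injOn hinj]
  refine Nat.le_of_mul_le_mul_right (le_trans (card_mul_cap_le ancestor (cap (n, L)) ?_) hlen)
    (hpos (n, L) d)
  intro r hr
  obtain ⟨b, hb, rfl⟩ := Finset.mem_image.1 hr
  exact (hA' b hb).2

/-- The complexity of a cube in the unit square is at most twice its level, up to a logarithmic
term. -/
theorem exists_kolmogorov_ofNat_le {U : List Bool →. ℕ} (hU : IsOptimalPrefixMachine U) :
    ∃ c : ℕ, ∀ (n s : ℕ) (q : ℕ × ℕ), q.1 < 2 ^ (n + 1) → q.2 < 2 ^ (n + 1) →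
      Nat.pair n (Nat.pair 0 (2 * (n + 1))) < 2 ^ s →
      kolmogorov U (ofNat (n, q)) ≤ 2 * (n + 1) + 2 * s + c := by
  have hf : Primrec₂ fun (z : ℕ × List Bool) (i : ℕ) =>
      if i.unpair.1 < 2 ^ (z.1 + 1) ∧ i.unpair.2 < 2 ^ (z.1 + 1) then some (z.1, i.unpair)
        else none := by
    have hz : Primrec fun y : (ℕ × List Bool) × ℕ => y.1.1 := Primrec.fst.comp .fst
    have h2 := primrec_two_pow.comp (Primrec.succ.comp hz)
    have hu : Primrec fun y : (ℕ × List Bool) × ℕ => y.2.unpair := Primrec.unpair.comp .snd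
    exact Primrec.ite ((Primrec.nat_lt.comp (Primrec.fst.comp hu) h2).and
      (Primrec.nat_lt.comp (Primrec.snd.comp hu) h2))
      (Primrec.option_some.comp (hz.pair hu)) (.const none)
  obtain ⟨c, hc⟩ := exists_kolmogorov_le hU hf primrec_ofNat
  refine ⟨c, fun n s q h1 h2 hs => ?_⟩
  have := hc n [] (2 * (n + 1)) s (Nat.pair q.1 q.2) (n, q) (by simp [h1, h2])
    (fun A hA => ?_) hs
  · simpa using this
  · have hsub : A ⊆ ({n} : Finset ℕ) ×ˢ
        (Finset.range (2 ^ (n + 1)) ×ˢ Finset.range (2 ^ (n + 1))) := by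
      intro b hb
      obtain ⟨j, hj⟩ := hA b hb
      split_ifs at hj with h
      cases hj
      simpa using h
    refine (Finset.card_le_card hsub).trans ?_
    simp only [Finset.card_product, Finset.card_singleton, Finset.card_range]
    rw [one_mul, ← pow_add, two_mul]

/-! ### The packing bound -/

/-- The capacity of a cube `d` levels above level `z.1`, when `L = z.2`: it is `2 ^ (L - u m / v)`
for a cube of level `m = z.1 - d`, except that a cube of level `z.1` may be selected only once. -/
def capacity (u v : ℕ) (z : ℕ × ℕ) (d : ℕ) : ℕ :=
  2 ^ if d = 0 then 0 else z.2 - u * (z.1 - d) / v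

theorem primrec_capacity (u v : ℕ) : Primrec₂ (capacity u v) := by
  have hz : Primrec fun y : (ℕ × ℕ) × ℕ => y.1 := .fst
  exact primrec_two_pow.comp (Primrec.ite (Primrec.eq.comp .snd (.const 0)) (.const 0)
    (Primrec.nat_sub.comp (Primrec.snd.comp hz) (Primrec.nat_div.comp
      (Primrec.nat_mul.comp (.const u) (Primrec.nat_sub.comp (Primrec.fst.comp hz) .snd))
      (.const v))))

theorem pair_lt_two_pow {a b r : ℕ} (ha : a < 2 ^ r) (hb : b < 2 ^ r) :
    Nat.pair a b < 2 ^ (2 * r) := by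
  refine (Nat.pair_lt_max_add_one_sq a b).trans_le ?_
  rw [mul_comm, pow_mul]
  exact Nat.pow_le_pow_left (max_lt ha hb) 2

theorem eventually_le_size (c : ℕ) : ∀ᶠ n : ℕ in atTop, c ≤ n.size := by
  filter_upwards [eventually_ge_atTop (2 ^ c)] with n hn
  exact (Nat.lt_size.2 hn).le

theorem eventually_complexityAt_lt {U : List Bool →. ℕ} (hU : IsOptimalPrefixMachine U)
    (x : EuclideanSpace ℝ (Fin 2)) :
    ∀ᶠ n : ℕ in atTop, containing n x ∈ family n → complexityAt U n x < 2 ^ (2 * n.size) := by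
  obtain ⟨c, hc⟩ := exists_kolmogorov_ofNat_le hU
  filter_upwards [eventually_le_size c, eventually_le_size 5] with n hcn h5 hx
  obtain ⟨q, hq, h1, h2⟩ := exists_ofNat_of_mem_family hx
  have hn : n < 2 ^ n.size := Nat.lt_size_self n
  have h32 : 2 ^ 5 * 2 ^ n.size ≤ 2 ^ (2 * n.size) := by
    rw [← pow_add]
    exact Nat.pow_le_pow_right two_pos (by omega)
  have hsz : n.size < 2 ^ n.size := Nat.lt_two_pow_self
  have hsn : n.size ≤ n := Nat.size_le.2 Nat.lt_two_pow_self
  have h8 := pair_lt_two_pow (hn.trans_le (Nat.pow_le_pow_right two_pos (by omega)))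
    (pair_lt_two_pow (a := 0) (b := 2 * (n + 1)) (r := 2 * n.size) (by positivity) (by omega))
  have := hc n _ q h1 h2 h8
  rw [complexityAt, hq]
  omega

/-- The packing bound. If `K_n(x) ≥ (u / v) n` for large `n`, then a finite set of cubes that
contains the cube of `x` and is enumerable given `w` has a subset in which a cube of level `m` holds
at most `2 ^ (K_n(x) - (u / v) m)` elements and which has nearly `2 ^ (K_n(x) - |w|)` elements. -/
theorem eventually_exists_packing {U : List Bool →. ℕ} (hU : IsOptimalPrefixMachine U)
    (x : EuclideanSpace ℝ (Fin 2)) {E : (ℕ × List Bool) × DyadicCube → Prop} (hE : REPred E)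
    {u v M : ℕ} (hK : ∀ n ≥ M, u * n ≤ v * complexityAt U n x) :
    ∀ᶠ n : ℕ in atTop, ∀ (w : List Bool) (P : Finset DyadicCube),
      (∀ Q ∈ P, Q ∈ family n) → IsEnumeratedBy E n w P → containing n x ∈ P →
      w.length ≤ complexityAt U n x →
      ∃ P' ⊆ P, (∀ m ≤ n, ∀ R ∈ family m, ∀ A ⊆ P', (∀ Q ∈ A, Q.toSet ⊆ R.toSet) →
          A.card ≤ 2 ^ (complexityAt U n x - u * m / v)) ∧
        2 ^ complexityAt U n x ≤ P'.card * 2 ^ (w.length + 33 * n.size) := by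
  have hE' : REPred fun z : (ℕ × List Bool) × (ℕ × ℕ) => E (z.1, ofNat (z.1.1, z.2)) := by
    have h : Primrec fun z : (ℕ × List Bool) × (ℕ × ℕ) => (z.1, ofNat (z.1.1, z.2)) :=
      Primrec.fst.pair (primrec_ofNat.comp ((Primrec.fst.comp .fst).pair .snd))
    exact Partrec.comp hE h.to_comp
  obtain ⟨f, hf, hfE⟩ := exists_primrec_enumeration
    (R := fun (z : ℕ × List Bool) (q : ℕ × ℕ) => E (z, ofNat (z.1, q))) hE'
  obtain ⟨c, hc⟩ := exists_kolmogorov_saturated_le hU hf (primrec_capacity u v)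
    (fun _ _ => Nat.pow_pos two_pos)
  filter_upwards [eventually_complexityAt_lt hU x, eventually_le_size (c + u * M + 1)]
    with n hL hcn w P hP hPE hx hw
  specialize hL (hP _ hx)
  set L := complexityAt U n x
  have hmem : ∀ q : ℕ × ℕ, ofNat (n, q) ∈ P ↔ ∃ i, f (n, w) i = some q := fun q => by
    rw [hPE, ← hfE]
  have h0 : capacity u v (n, L) 0 ≤ 1 := by simp [capacity]
  have hinj : Function.Injective fun q : ℕ × ℕ => ofNat (n, q) := fun a b h => by
    simpa using ofNat_injective h
  obtain ⟨T, hT⟩ := exists_forall_pack_suffix ancestor (f (n, w)) n (capacity u v (n, L)) h0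
    (P := P.preimage _ hinj.injOn) (fun i a hi => by
      rw [Finset.mem_preimage]
      exact (hmem a).2 ⟨i, hi⟩)
  set G := pack ancestor (f (n, w)) n (capacity u v (n, L)) T
  have hnodup : G.Nodup := nodup_pack _ _ _ _ h0 _
  have hcard : (G.toFinset.image fun q => ofNat (n, q)).card = G.length := by
    rw [Finset.card_image_of_injective _ hinj, List.toFinset_card_of_nodup hnodup]
  refine ⟨G.toFinset.image fun q => ofNat (n, q), ?_, ?_, ?_⟩
  · intro Q hQ
    obtain ⟨q, hq, rfl⟩ := Finset.mem_image.1 hQ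
    exact (hmem q).2 (exists_of_mem_pack _ _ _ _ (List.mem_toFinset.1 hq))
  · rintro m hm R ⟨rfl, -⟩ A hA hAR
    have hsub : A ⊆ ((G.filter fun q => decide (ancestor (n - R.level) q =
        (R.2.1.toNat, R.2.2.toNat))).toFinset.image fun q => ofNat (n, q)) := by
      intro Q hQ
      obtain ⟨q, hq, rfl⟩ := Finset.mem_image.1 (hA hQ)
      have hR := eq_ancestor_of_subset hm (hAR _ hQ)
      refine Finset.mem_image_of_mem _ (List.mem_toFinset.2 (List.mem_filter.2
        ⟨List.mem_toFinset.1 hq, decide_eq_true ?_⟩))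
      have h2 := congrArg Prod.snd hR
      rw [h2]
      simp [ofNat]
    calc A.card ≤ _ := (Finset.card_le_card hsub).trans
          (Finset.card_image_le.trans (List.toFinset_card_le _))
      _ ≤ capacity u v (n, L) (n - R.level) := load_pack_le _ _ _ _ _ (by omega) _
      _ ≤ _ := by
        refine Nat.pow_le_pow_right two_pos ?_
        split_ifs with h
        · exact Nat.zero_le _
        · dsimp only
          rw [Nat.sub_sub_self hm]
  · rw [hcard]
    obtain ⟨q, hq, -⟩ := exists_ofNat_of_mem_family (hP _ hx)
    obtain ⟨i, hi⟩ := (hmem q).1 (hq ▸ hx)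
    obtain ⟨d, hd, hsat⟩ := exists_cap_le_load ancestor (f (n, w)) n (capacity u v (n, L)) h0 hi
    obtain ⟨e, he⟩ : ∃ e, e = if d = 0 then 0 else L - u * (n - d) / v := ⟨_, rfl⟩
    have hcap : capacity u v (n, L) d = 2 ^ e := by rw [he]; rfl
    have hcl : 2 ^ e ≤ G.length := by
      rw [← hcap]
      exact hsat.trans ((load_le_of_suffix (hT _) _ _).trans (List.length_filter_le _ _))
    have hKm : L ≤ complexityAt U (n - d) x + e + u * M := by
      rw [he]
      split_ifs with h
      · rw [h, Nat.sub_zero]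
        omega
      · have : u * (n - d) / v ≤ complexityAt U (n - d) x + u * M := by
          rcases le_total M (n - d) with hM | hM
          · exact (Nat.div_le_of_le_mul (hK _ hM)).trans (Nat.le_add_right _ _)
          · exact (Nat.div_le_self _ _).trans
              ((Nat.mul_le_mul_left u hM).trans (Nat.le_add_left _ _))
        omega
    by_cases hbig : 2 ^ L ≤ G.length
    · exact hbig.trans (Nat.le_mul_of_pos_right _ (Nat.pow_pos two_pos))
    -- the least `l` with `|G| ≤ 2 ^ l * 2 ^ e`
    obtain ⟨l, hl1, hl2⟩ : ∃ l, G.length ≤ 2 ^ l * 2 ^ e ∧ 2 ^ l * 2 ^ e ≤ 2 * G.length := by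
      have hex : ∃ l, G.length ≤ 2 ^ l * 2 ^ e :=
        ⟨G.length, Nat.lt_two_pow_self.le.trans
          (Nat.le_mul_of_pos_right _ (Nat.pow_pos two_pos))⟩
      refine ⟨Nat.find hex, Nat.find_spec hex, ?_⟩
      rcases hk : Nat.find hex with _ | k
      · rw [pow_zero, one_mul]
        omega
      · have := Nat.find_min hex (m := k) (by omega)
        rw [pow_succ, mul_comm (2 ^ k), mul_assoc]
        omega
    have hlL : l ≤ L := by
      have h1 : 2 ^ l < 2 ^ (L + 1) := by
        have := Nat.le_mul_of_pos_right (2 ^ l) (Nat.pow_pos (n := e) two_pos)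
        rw [pow_succ]
        omega
      have := (Nat.pow_lt_pow_iff_right one_lt_two).1 h1
      omega
    have hn : n < 2 ^ (2 * n.size) :=
      (Nat.lt_size_self n).trans_le (Nat.pow_le_pow_right two_pos (by omega))
    have hs : Nat.pair (Nat.pair n (Nat.pair d L)) (Nat.pair w.length l) <
        2 ^ (2 * (2 * (2 * (2 * n.size)))) := by
      refine pair_lt_two_pow (pair_lt_two_pow ?_ ?_) ?_
      · exact hn.trans_le (Nat.pow_le_pow_right two_pos (by omega))
      · exact pair_lt_two_pow (by omega) hL
      · exact (pair_lt_two_pow (hw.trans_lt hL) (hlL.trans_lt hL)).trans_le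
          (Nat.pow_le_pow_right two_pos (by omega))
    have hfin := hc n d L l _ i T w q hd hi hsat hT (by rw [hcap]; exact hl1) hs
    have hanc := containing_eq_ancestor (Nat.sub_le n d) hq
    rw [Nat.sub_sub_self hd] at hanc
    rw [← hanc, ← complexityAt] at hfin
    calc 2 ^ L ≤ 2 ^ ((l + e) + (w.length + 32 * n.size + c + u * M)) :=
          Nat.pow_le_pow_right two_pos (by omega)
      _ = (2 ^ l * 2 ^ e) * 2 ^ (w.length + 32 * n.size + c + u * M) := by
          rw [pow_add, pow_add]
      _ ≤ (2 * G.length) * 2 ^ (w.length + 32 * n.size + c + u * M) :=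
          Nat.mul_le_mul_right _ hl2
      _ = G.length * 2 ^ (w.length + 32 * n.size + c + u * M + 1) := by ring
      _ ≤ _ := Nat.mul_le_mul_left _ (Nat.pow_le_pow_right two_pos (by omega))

end DyadicCube

/-! ### Dyadic sets with real parameters -/

theorem exists_rate_of_lt_effDim {U : List Bool →. ℕ} {x : EuclideanSpace ℝ (Fin 2)} {t : ℝ}
    (h : ENNReal.ofReal t < effDim U x) :
    ∃ u v M : ℕ, 0 < v ∧ t * v ≤ u ∧ ∀ n ≥ M, u * n ≤ v * complexityAt U n x := by
  obtain ⟨q, hq0, htq, hq⟩ := ENNReal.lt_iff_exists_rat_btwn.1 h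
  obtain ⟨M, hM⟩ := eventually_atTop.1 (eventually_lt_of_lt_liminf hq)
  have htq' : t < (q : ℝ) := by
    rcases lt_or_ge t 0 with ht | ht
    · exact ht.trans_le (by exact_mod_cast hq0)
    · exact (ENNReal.ofReal_lt_ofReal_iff_of_nonneg ht).1 htq
  have hden : (0 : ℝ) < q.den := by exact_mod_cast q.pos
  have hqd : (q : ℝ) = (q.num.toNat : ℝ) / (q.den : ℝ) := by
    have h1 : ((q.num.toNat : ℤ) : ℝ) = (q.num : ℝ) := by
      rw [Int.toNat_of_nonneg (Rat.num_nonneg.2 hq0)]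
    rw [Rat.cast_def, ← h1, Int.cast_natCast]
  refine ⟨q.num.toNat, q.den, M + 1, q.pos, ?_, fun n hn => ?_⟩
  · rw [hqd, lt_div_iff₀ hden] at htq'
    exact htq'.le
  · have hn0 : (0 : ℝ) < n := by exact_mod_cast (by omega : 0 < n)
    have h1 := hM n (by omega)
    have h2 : ENNReal.ofReal (q : ℝ) < ENNReal.ofReal ((complexityAt U n x : ℝ) / n) := by
      rw [ENNReal.ofReal_div_of_pos hn0, ENNReal.ofReal_natCast, ENNReal.ofReal_natCast]
      exact h1
    have h3 := (ENNReal.ofReal_lt_ofReal_iff_of_nonneg (by exact_mod_cast hq0)).1 h2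
    rw [hqd, div_lt_div_iff₀ hden hn0] at h3
    have h4 : q.num.toNat * n < complexityAt U n x * q.den := by exact_mod_cast h3
    rw [mul_comm q.den]
    exact h4.le

theorem eventually_mul_logb_le (A : ℝ) {δ : ℝ} (hδ : 0 < δ) :
    ∀ᶠ n : ℕ in atTop, A * Real.logb 2 n ≤ δ * n := by
  have h2 : 0 < Real.log 2 := Real.log_pos one_lt_two
  have hA : 0 < |A| + 1 := by positivity
  have h := (Real.isLittleO_log_id_atTop.comp_tendsto tendsto_natCast_atTop_atTop).bound
    (c := δ * Real.log 2 / (|A| + 1)) (by positivity)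
  filter_upwards [h, eventually_ge_atTop 1] with n hn h1
  have hlog : 0 ≤ Real.log n := Real.log_natCast_nonneg n
  simp only [Function.comp_apply, id, Real.norm_eq_abs, abs_of_nonneg hlog, Nat.abs_cast] at hn
  rw [div_mul_eq_mul_div, le_div_iff₀ hA] at hn
  rw [Real.logb, ← mul_div_assoc, div_le_iff₀ h2]
  nlinarith [le_abs_self A]

theorem size_le_two_mul_logb {n : ℕ} (hn : 2 ≤ n) : (n.size : ℝ) ≤ 2 * Real.logb 2 n := by
  have h1 : 1 ≤ Real.logb 2 n := by
    rw [Real.le_logb_iff_rpow_le one_lt_two (by positivity), Real.rpow_one]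
    exact_mod_cast hn
  have h2 : ((n.size - 1 : ℕ) : ℝ) ≤ Real.logb 2 n := by
    rw [Real.le_logb_iff_rpow_le one_lt_two (by positivity), Real.rpow_natCast]
    have hpos : 0 < n.size := Nat.size_pos.2 (by omega)
    exact_mod_cast Nat.lt_size.1 (by omega : n.size - 1 < n.size)
  have h3 : (n.size : ℝ) ≤ ((n.size - 1 : ℕ) : ℝ) + 1 := by exact_mod_cast (by omega)
  linarith

theorem IsDyadicSet.mono {n : ℕ} {s C C' : ℝ} {A : Finset DyadicCube} (h : IsDyadicSet n s C A)
    (hC : C ≤ C') : IsDyadicSet n s C' A :=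
  ⟨h.1, fun m hm Q hQ => (h.2 m hm Q hQ).trans (by gcongr)⟩

/-- A set that packs well is a dyadic set. The summand `1` in the exponent compensates for the
rounding of `u m / v`. -/
theorem isDyadicSet_of_packing {n L u v : ℕ} {t B : ℝ} {A : Finset DyadicCube} (hv : 0 < v)
    (htv : t * v ≤ u) (hA : ∀ Q ∈ A, Q ∈ DyadicCube.family n) (hL : u * n ≤ v * L)
    (hcard : (2 : ℝ) ^ ((L : ℝ) - B) ≤ A.card)
    (hpack : ∀ m ≤ n, ∀ R ∈ DyadicCube.family m, ∀ A' ⊆ A, (∀ Q ∈ A', Q.toSet ⊆ R.toSet) →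
      A'.card ≤ 2 ^ (L - u * m / v)) :
    IsDyadicSet n t ((2 : ℝ) ^ (B + 1)) A := by
  classical
  refine ⟨hA, fun m hm R hR => ?_⟩
  have hle : u * m / v ≤ L :=
    Nat.div_le_of_le_mul ((Nat.mul_le_mul_left u hm).trans hL)
  have hdiv : t * m ≤ ((u * m / v : ℕ) : ℝ) + 1 := by
    have hv' : (0 : ℝ) < v := by exact_mod_cast hv
    have h1 : ((u * m : ℕ) : ℝ) ≤ v * (((u * m / v : ℕ) : ℝ) + 1) := by
      exact_mod_cast (Nat.lt_mul_div_succ (u * m) hv).le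
    have h2 : t * v * m ≤ u * m := mul_le_mul_of_nonneg_right htv m.cast_nonneg
    push_cast at h1
    refine le_of_mul_le_mul_left ?_ hv'
    linarith
  have h := hpack m hm R hR _ (Finset.filter_subset (fun Q => Q.toSet ⊆ R.toSet) A)
    fun Q hQ => (Finset.mem_filter.1 hQ).2
  calc _ ≤ ((2 ^ (L - u * m / v) : ℕ) : ℝ) := by
        refine le_trans (le_of_eq ?_) (Nat.cast_le.2 h)
        congr!
    _ = (2 : ℝ) ^ ((L : ℝ) - ((u * m / v : ℕ) : ℝ)) := by
        rw [← Nat.cast_sub hle, Real.rpow_natCast]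
        push_cast
        rfl
    _ ≤ (2 : ℝ) ^ ((B + 1) + -(t * m) + (L - B)) :=
        Real.rpow_le_rpow_of_exponent_le one_le_two (by linarith)
    _ = (2 : ℝ) ^ (B + 1) * (2 : ℝ) ^ (-(t * m)) * (2 : ℝ) ^ ((L : ℝ) - B) := by
        rw [Real.rpow_add two_pos, Real.rpow_add two_pos]
    _ ≤ _ := by gcongr

theorem isDyadicSet_singleton {n : ℕ} {t C : ℝ} {Q : DyadicCube} (ht : 0 ≤ t)
    (hQ : Q ∈ DyadicCube.family n) (hC : (2 : ℝ) ^ (t * n) ≤ C) : IsDyadicSet n t C {Q} := by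
  classical
  refine ⟨fun R hR => Finset.mem_singleton.1 hR ▸ hQ, fun m hm R _ => ?_⟩
  have h1 : (((({Q} : Finset DyadicCube).filter fun Q' => Q'.toSet ⊆ R.toSet).card : ℕ) : ℝ) ≤
      1 := by
    exact_mod_cast (Finset.card_filter_le _ _).trans (Finset.card_singleton Q).le
  refine le_trans (le_of_eq (by congr!)) (h1.trans ?_)
  rw [Finset.card_singleton, Nat.cast_one, mul_one]
  calc (1 : ℝ) ≤ (2 : ℝ) ^ (t * n + -(t * m)) := by
        refine Real.one_le_rpow one_le_two ?_
        have : t * m ≤ t * n := mul_le_mul_of_nonneg_left (by exact_mod_cast hm) ht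
        linarith
    _ = (2 : ℝ) ^ (t * n) * (2 : ℝ) ^ (-(t * m)) := Real.rpow_add two_pos _ _
    _ ≤ _ := by gcongr

theorem eventually_exists_isDyadicSet {U : List Bool →. ℕ} (hU : IsOptimalPrefixMachine U)
    {x : EuclideanSpace ℝ (Fin 2)} {t δ : ℝ} (ht : 0 < t) (htx : ENNReal.ofReal t < effDim U x)
    (hδ : 0 < δ) {E : (ℕ × List Bool) × DyadicCube → Prop} (hE : REPred E) :
    ∀ᶠ n : ℕ in atTop, ∀ (w : List Bool) (P : Finset DyadicCube),
      (∀ Q ∈ P, Q ∈ DyadicCube.family n) → IsEnumeratedBy E n w P →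
      DyadicCube.containing n x ∈ P →
      ∃ P' ⊆ P, IsDyadicSet n t ((2 : ℝ) ^ (δ * n + w.length)) P' ∧
        (2 : ℝ) ^ ((complexityAt U n x : ℝ) - 66 * Real.logb 2 n - w.length) ≤ P'.card := by
  obtain ⟨u, v, M, hv, htv, hM⟩ := exists_rate_of_lt_effDim htx
  filter_upwards [DyadicCube.eventually_exists_packing hU x hE hM, eventually_ge_atTop M,
    eventually_ge_atTop 2, eventually_mul_logb_le 67 hδ] with n hn hnM hn2 hlog w P hP hPE hx
  have hlog1 : 1 ≤ Real.logb 2 n := by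
    rw [Real.le_logb_iff_rpow_le one_lt_two (by positivity), Real.rpow_one]
    exact_mod_cast hn2
  have hKn := hM n hnM
  by_cases hw : w.length ≤ complexityAt U n x
  · obtain ⟨P', hPP, hpack, hcard⟩ := hn w P hP hPE hx hw
    have hcard' : (2 : ℝ) ^ ((complexityAt U n x : ℝ) - (66 * Real.logb 2 n + w.length)) ≤
        P'.card := by
      have h1 : (2 : ℝ) ^ (complexityAt U n x : ℝ) ≤
          P'.card * (2 : ℝ) ^ ((w.length : ℝ) + 33 * n.size) := by
        have : ((w.length : ℝ) + 33 * n.size) = ((w.length + 33 * n.size : ℕ) : ℝ) := by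
          push_cast
          rfl
        rw [this, Real.rpow_natCast, Real.rpow_natCast]
        exact_mod_cast hcard
      rw [Real.rpow_sub two_pos, div_le_iff₀ (by positivity)]
      refine h1.trans (mul_le_mul_of_nonneg_left
        (Real.rpow_le_rpow_of_exponent_le one_le_two ?_) (Nat.cast_nonneg _))
      linarith [size_le_two_mul_logb hn2]
    refine ⟨P', hPP, (isDyadicSet_of_packing hv htv (fun Q hQ => hP Q (hPP hQ)) hKn hcard'
      hpack).mono (Real.rpow_le_rpow_of_exponent_le one_le_two ?_), ?_⟩
    · linarith
    · rwa [sub_sub]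
  · -- if `w` is longer than `K_n(x)`, one cube suffices
    push Not at hw
    have hw' : (complexityAt U n x : ℝ) ≤ w.length := by exact_mod_cast hw.le
    have htn : t * n ≤ complexityAt U n x := by
      have hv' : (0 : ℝ) < v := by exact_mod_cast hv
      have h1 : (u : ℝ) * n ≤ v * complexityAt U n x := by exact_mod_cast hKn
      have h2 : t * v * n ≤ u * n := mul_le_mul_of_nonneg_right htv n.cast_nonneg
      refine le_of_mul_le_mul_left ?_ hv'
      linarith
    refine ⟨{DyadicCube.containing n x}, Finset.singleton_subset_iff.2 hx,
      isDyadicSet_singleton ht.le (hP _ hx)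
        (Real.rpow_le_rpow_of_exponent_le one_le_two ?_), ?_⟩
    · have : 0 ≤ δ * n := by positivity
      linarith
    · rw [Finset.card_singleton, Nat.cast_one]
      exact Real.rpow_le_one_of_one_le_of_nonpos one_le_two (by linarith)

theorem proposition3p3 (U : List Bool →. ℕ) (hU : IsOptimalPrefixMachine U)
    (ε₀ : ℝ) (hε₀ : 0 < ε₀) :
    (∃ c : ℝ, 0 < c ∧
      ∀ (x : EuclideanSpace ℝ (Fin 2)) (t ε : ℝ), 0 < t → ENNReal.ofReal t < effDim U x →
        0 < ε → ε ≤ ε₀ →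
      ∀ E : (ℕ × List Bool) × DyadicCube → Prop, REPred E →
      ∃ N : ℕ, ∀ n ≥ N, ∀ (w : List Bool) (P : Finset DyadicCube),
        (∀ Q ∈ P, Q ∈ DyadicCube.family n) → IsEnumeratedBy E n w P →
        DyadicCube.containing n x ∈ P →
        ∃ P' ⊆ P,
          IsDyadicSet n t ((2 : ℝ) ^ (c * (ε * (n : ℝ)) + (w.length : ℝ))) P' ∧
          (2 : ℝ) ^ ((complexityAt U n x : ℝ) - c * (ε⁻¹ * Real.logb 2 (n : ℝ)) -
            (w.length : ℝ)) ≤ (P'.card : ℝ)) ∧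
    (∀ a : ℝ, 0 < a → ∃ c : ℝ, 0 < c ∧
      ∀ (x : EuclideanSpace ℝ (Fin 2)) (t ε : ℝ), 0 < t → ENNReal.ofReal t < effDim U x →
        0 < ε → ε ≤ ε₀ →
      ∀ E : (ℕ × List Bool) × DyadicCube → Prop, REPred E →
      ∃ N : ℕ, ∀ n ≥ N, ∀ (w : List Bool) (P : Finset DyadicCube),
        (w.length : ℝ) ≤ a * Real.logb 2 (n : ℝ) →
        (∀ Q ∈ P, Q ∈ DyadicCube.family n) → IsEnumeratedBy E n w P →
        DyadicCube.containing n x ∈ P →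
        ∃ P' ⊆ P,
          IsDyadicSet n t ((2 : ℝ) ^ (c * (ε * (n : ℝ)))) P' ∧
          (2 : ℝ) ^ ((complexityAt U n x : ℝ) - c * (ε⁻¹ * Real.logb 2 (n : ℝ))) ≤
            (P'.card : ℝ)) := by
  -- since `ε ≤ ε₀`, a multiple of `log n` is absorbed by a multiple of `ε⁻¹ log n`
  have habs : ∀ (A ε : ℝ), 0 ≤ A → 0 < ε → ε ≤ ε₀ → ∀ n : ℕ,
      A * Real.logb 2 n ≤ A * ε₀ * (ε⁻¹ * Real.logb 2 n) := by
    intro A ε hA hε hle n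
    have hlog : 0 ≤ Real.logb 2 n := div_nonneg (Real.log_natCast_nonneg n)
      (Real.log_nonneg one_le_two)
    have h1 : 1 ≤ ε₀ * ε⁻¹ := by rwa [← div_eq_mul_inv, one_le_div hε]
    calc A * Real.logb 2 n ≤ A * Real.logb 2 n * (ε₀ * ε⁻¹) :=
          le_mul_of_one_le_right (mul_nonneg hA hlog) h1
      _ = _ := by ring
  refine ⟨⟨1 + 66 * ε₀, by positivity, ?_⟩, fun a ha => ⟨2 + (66 + a) * ε₀, by positivity, ?_⟩⟩
  all_goals
    intro x t ε ht htx hε hle E hE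
    have hev := eventually_exists_isDyadicSet hU ht htx hε hE
  · obtain ⟨N, hN⟩ := eventually_atTop.1 hev
    refine ⟨N, fun n hn w P hP hPE hx => ?_⟩
    obtain ⟨P', hPP, hdy, hcard⟩ := hN n hn w P hP hPE hx
    have hpos : 0 ≤ ε₀ * (ε * n) := by positivity
    have hlog : 0 ≤ ε⁻¹ * Real.logb 2 n := mul_nonneg (by positivity)
      (div_nonneg (Real.log_natCast_nonneg n) (Real.log_nonneg one_le_two))
    refine ⟨P', hPP, hdy.mono (Real.rpow_le_rpow_of_exponent_le one_le_two ?_),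
      (Real.rpow_le_rpow_of_exponent_le one_le_two ?_).trans hcard⟩
    · linarith
    · linarith [habs 66 ε (by norm_num) hε hle n]
  · obtain ⟨N, hN⟩ := eventually_atTop.1 (hev.and (eventually_mul_logb_le a hε))
    refine ⟨N, fun n hn w P hw hP hPE hx => ?_⟩
    obtain ⟨P', hPP, hdy, hcard⟩ := (hN n hn).1 w P hP hPE hx
    have ha' := (hN n hn).2
    have hpos : 0 ≤ (66 + a) * (ε₀ * (ε * n)) := by positivity
    have hlog : 0 ≤ ε⁻¹ * Real.logb 2 n := mul_nonneg (by positivity)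
      (div_nonneg (Real.log_natCast_nonneg n) (Real.log_nonneg one_le_two))
    refine ⟨P', hPP, hdy.mono (Real.rpow_le_rpow_of_exponent_le one_le_two ?_),
      (Real.rpow_le_rpow_of_exponent_le one_le_two ?_).trans hcard⟩
    · linarith
    · linarith [habs (66 + a) ε (by positivity) hε hle n]
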